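/- Let $(x_i,y_i)_{i=1}^n$ with $x_i\in\mathbb R^d$ pairwise distinct and $y_i\in\{-1,+1\}$, and put $z_i=y_ix_i$. Assume the data are linearly separable: there is $w\in\mathbb R^d$ with $\langle w,z_i\rangle>0$ for all $i$. Let $\bar u$ be the $\ell_2$ max-margin separator, that is, the unit vector maximizing $\min_i\langle u,z_i\rangle$ over all unit vectors $u$, and let $\gamma=\max_{\|u\|=1}\min_i\langle u,z_i\rangle=\min_i\langle\bar u,z_i\rangle$ be the maximal margin. Assume that the support vectors, i.e. the points $z_i$ with $\langle\bar u,z_i\rangle=\gamma$, span $\mathbb R^d$. Let $\eta>0$ and $\alpha>\gamma\eta$. For a linear model $f(x)=\langle u,x\rangle$ and a level $\beta\in\mathbb R$ the complete hinge loss is $$\widehat{\mathcal R}(u,\beta)=-\sum_{i=1}^n\mathbf 1[\langle u,z_i\rangle\le\beta]\,\langle u,z_i\rangle-\mathbf 1\Big[\sum_{i=1}^n\max\{\beta-\langle u,z_i\rangle,0\}=0\Big]\frac{\alpha}{\eta}\beta .$$ Gradient descent on $(u,\beta)$ with constant step size $\eta$, in which the indicator functions are treated as locally constant and are not differentiated,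 started at an arbitrary $u_0\in\mathbb R^d$ and $\beta(0)=0$, produces the iterates $$u_{t+1}=u_t+\eta\sum_{i=1}^n\mathbf 1[\langle u_t,z_i\rangle\le\beta(t)]\,z_i,\qquad \beta(t+1)=\beta(t)+\alpha\,\mathbf 1\big[\langle u_t,z_i\rangle\ge\beta(t)\text{ for all }i\big].$$ Then $u_t\neq0$ for all large $t$ and, as $t\to\infty$, $$\gamma-\min_{1\le i\le n}\Big\langle\frac{u_t}{\|u_t\|},z_i\Big\rangle=\mathcal O\Big(\frac nt\Big),$$ and consequently $$1-\Big\langle\frac{u_t}{\|u_t\|},\bar u\Big\rangle=\mathcal O\Big(\frac nt\Big),\qquad \Big\|\frac{u_t}{\|u_t\|}-\bar u\Big\|=\mathcal O\Big(\sqrt{\frac nt}\Big).$$ The implied constants may depend on the data set, on $\alpha$, $\eta$ and on the initial point $u_0$, but not on $t$. -/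

import Mathlib

open Filter Topology

noncomputable section

namespace CompleteHinge

/-- The ambient Euclidean space `ℝ^d` with its `ℓ²` inner product and norm. -/
abbrev E (d : ℕ) : Type := EuclideanSpace ℝ (Fin d)

/-! ### Data, margins, support vectors -/

/-- The signed data points `z i = y i • x i`. -/
def signedData {d n : ℕ} (x : Fin n → E d) (y : Fin n → ℝ) : Fin n → E d :=
  fun i => y i • x i

/-- Linear separability (by a hyperplane through the origin). -/
def LinearlySeparable {d n : ℕ} (z : Fin n → E d) : Prop :=
  ∃ w : E d, ∀ i, 0 < inner ℝ w (z i)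

/-- The margin `min_i ⟪u, z i⟫` of `u` (a minimum over a finite family). -/
def margin {d n : ℕ} (z : Fin n → E d) (u : E d) : ℝ :=
  ⨅ i, inner ℝ u (z i)

/-- The maximal margin `γ = max_{‖u‖ = 1} min_i ⟪u, z i⟫`. -/
def maxMargin {d n : ℕ} (z : Fin n → E d) : ℝ :=
  sSup (margin z '' Metric.sphere (0 : E d) 1)

/-- `ubar` is a unit vector that maximizes the margin among all unit vectors. -/
structure IsMaxMarginSeparator {d n : ℕ} (z : Fin n → E d) (ubar : E d) : Prop where
  norm_eq_one : ‖ubar‖ = 1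
  le_margin : ∀ u : E d, ‖u‖ = 1 → margin z u ≤ margin z ubar

/-- The support vectors: the data points at which `ubar` attains exactly the maximal margin. -/
def supportVectors {d n : ℕ} (z : Fin n → E d) (ubar : E d) : Set (E d) :=
  {s | s ∈ Set.range z ∧ inner ℝ ubar s = maxMargin z}

/-! ### The complete hinge loss -/

/-- The expression for the complete hinge loss of the model `f` at level `β`, in which the two
indicator functions are evaluated at `(f₀, β₀)`. -/
def activatedRisk {d n : ℕ} (x : Fin n → E d) (y : Fin n → ℝ) (α η : ℝ)
    (f₀ : E d → ℝ) (β₀ : ℝ) (f : E d → ℝ) (β : ℝ) : ℝ :=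
  -(∑ i, (if f₀ (x i) * y i ≤ β₀ then (1 : ℝ) else 0) * (f (x i) * y i))
    - (if ∑ i, max (β₀ - f₀ (x i) * y i) 0 = 0 then (1 : ℝ) else 0) * (α / η * β)

/-- The empirical complete hinge loss
`-∑ 1[f(xᵢ)yᵢ ≤ β] f(xᵢ)yᵢ - 1[∑ max (β - f(xᵢ)yᵢ) 0 = 0] (α/η) β`. -/
def risk {d n : ℕ} (x : Fin n → E d) (y : Fin n → ℝ) (α η : ℝ) (f : E d → ℝ) (β : ℝ) : ℝ :=
  activatedRisk x y α η f β f β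

/-- The linear model `v ↦ ⟪u, v⟫`. -/
def linearModel {d : ℕ} (u : E d) : E d → ℝ := fun v => inner ℝ u v

/-- Gradient of the complete hinge loss of the linear model with respect to `u` at `(u, β)`.
The indicators are piecewise constant, and they are not differentiated, also at the
jumps. -/
def gradU {d n : ℕ} (x : Fin n → E d) (y : Fin n → ℝ) (α η : ℝ) (u : E d) (β : ℝ) : E d :=
  gradient (fun v => activatedRisk x y α η (linearModel u) β (linearModel v) β) u

/-- Derivative of the complete hinge loss of the linear model with respect to `β` at `(u, β)`;
again the indicators are not differentiated. -/
def gradBeta {d n : ℕ} (x : Fin n → E d) (y : Fin n → ℝ) (α η : ℝ) (u : E d) (β : ℝ) : ℝ :=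
  deriv (fun b => activatedRisk x y α η (linearModel u) β (linearModel u) b) β

/-- Gradient descent with constant step size `η` on the parameters `(u, β)`, started at
`(u₀, 0)`; the value at `t` is the pair `(u_t, β(t))`. -/
def iterate {d n : ℕ} (x : Fin n → E d) (y : Fin n → ℝ) (α η : ℝ) (u₀ : E d) : ℕ → E d × ℝ
  | 0 => (u₀, 0)
  | t + 1 =>
    ((iterate x y α η u₀ t).1
        - η • gradU x y α η (iterate x y α η u₀ t).1 (iterate x y α η u₀ t).2,
      (iterate x y α η u₀ t).2
        - η * gradBeta x y α η (iterate x y α η u₀ t).1 (iterate x y α η u₀ t).2)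

/-! ### The explicit form of the gradients -/

theorem gradU_eq {d n : ℕ} (x : Fin n → E d) (y : Fin n → ℝ) (α η : ℝ) (u : E d) (β : ℝ) :
    gradU x y α η u β =
      -∑ i, (if inner ℝ u (signedData x y i) ≤ β then (1 : ℝ) else 0) • signedData x y i := by
  set G : E d :=
    -∑ i, (if inner ℝ u (signedData x y i) ≤ β then (1 : ℝ) else 0) • signedData x y i with hG
  obtain ⟨c, hc⟩ : ∃ c : ℝ, ∀ v : E d,
      activatedRisk x y α η (linearModel u) β (linearModel v) β = inner ℝ G v + c := by
    refine ⟨-((if ∑ i, max (β - linearModel u (x i) * y i) 0 = 0 then (1 : ℝ) else 0)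
      * (α / η * β)), fun v => ?_⟩
    rw [activatedRisk, hG, inner_neg_left, sum_inner, ← sub_eq_add_neg]
    congr 2
    refine Finset.sum_congr rfl fun i _ => ?_
    have e : ∀ w : E d, inner ℝ w (signedData x y i) = inner ℝ w (x i) * y i := fun w => by
      rw [signedData, inner_smul_right, mul_comm]
    rw [real_inner_smul_left, real_inner_comm v (signedData x y i), e v, e u]
    rfl
  have h : HasGradientAt
      (fun v => activatedRisk x y α η (linearModel u) β (linearModel v) β) G u := by
    simp only [hc]
    rw [hasGradientAt_iff_hasFDerivAt]
    exact ((InnerProductSpace.toDual ℝ (E d) G).hasFDerivAt (x := u)).add_const c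
  exact h.gradient

theorem gradBeta_eq {d n : ℕ} (x : Fin n → E d) (y : Fin n → ℝ) (α η : ℝ) (u : E d) (β : ℝ) :
    gradBeta x y α η u β =
      -((if ∀ i, β ≤ inner ℝ u (signedData x y i) then (1 : ℝ) else 0) * (α / η)) := by
  have h0 : (∑ i, max (β - linearModel u (x i) * y i) 0 = 0) ↔
      ∀ i, β ≤ inner ℝ u (signedData x y i) := by
    rw [Finset.sum_eq_zero_iff_of_nonneg fun i _ => le_max_right _ _]
    simp [linearModel, signedData, inner_smul_right, mul_comm]
  simp only [gradBeta, activatedRisk, h0]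
  rw [deriv_const_sub, deriv_const_mul_field, deriv_const_mul_field, deriv_id'', mul_one]

/-! ### Away from the jumps, these are the true derivatives of the loss -/

theorem risk_eventuallyEq {d n : ℕ} (x : Fin n → E d) (y : Fin n → ℝ) (α η : ℝ)
    (u : E d) (β : ℝ) (h : ∀ i, linearModel u (x i) * y i ≠ β) :
    ∀ᶠ p in 𝓝 (u, β), risk x y α η (linearModel p.1) p.2 =
      activatedRisk x y α η (linearModel u) β (linearModel p.1) p.2 := by
  have key : ∀ i, ∀ᶠ p in 𝓝 (u, β),
      ((linearModel p.1 (x i) * y i ≤ p.2 ↔ linearModel u (x i) * y i ≤ β) ∧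
        (p.2 ≤ linearModel p.1 (x i) * y i ↔ β ≤ linearModel u (x i) * y i)) := by
    intro i
    have hc : ContinuousAt (fun p : E d × ℝ => linearModel p.1 (x i) * y i) (u, β) := by
      unfold linearModel; fun_prop
    have hs : ContinuousAt (fun p : E d × ℝ => p.2) (u, β) := by fun_prop
    rcases lt_or_gt_of_ne (h i) with hlt | hgt
    · filter_upwards [hc.eventually_lt hs hlt] with p hp
      exact ⟨iff_of_true hp.le hlt.le, iff_of_false hp.not_ge hlt.not_ge⟩
    · filter_upwards [hs.eventually_lt hc hgt] with p hp
      exact ⟨iff_of_false hp.not_ge hgt.not_ge, iff_of_true hp.le hgt.le⟩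
  filter_upwards [eventually_all.2 key] with p hp
  have hz : ∀ (f : E d → ℝ) (b : ℝ), (∑ i, max (b - f (x i) * y i) 0 = 0) ↔
      ∀ i, b ≤ f (x i) * y i := by
    intro f b
    rw [Finset.sum_eq_zero_iff_of_nonneg fun i _ => le_max_right _ _]
    simp
  simp only [risk, activatedRisk, hz, (hp _).1, (hp _).2]

theorem gradU_eq_gradient_risk {d n : ℕ} (x : Fin n → E d) (y : Fin n → ℝ) (α η : ℝ)
    (u : E d) (β : ℝ) (h : ∀ i, linearModel u (x i) * y i ≠ β) :
    gradU x y α η u β = gradient (fun v => risk x y α η (linearModel v) β) u := by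
  have hc : Tendsto (fun v : E d => (v, β)) (𝓝 u) (𝓝 (u, β)) :=
    Continuous.tendsto (by fun_prop) u
  have he : (fun v => risk x y α η (linearModel v) β) =ᶠ[𝓝 u]
      (fun v => activatedRisk x y α η (linearModel u) β (linearModel v) β) :=
    hc.eventually (risk_eventuallyEq x y α η u β h)
  exact he.gradient_eq.symm

theorem gradBeta_eq_deriv_risk {d n : ℕ} (x : Fin n → E d) (y : Fin n → ℝ) (α η : ℝ)
    (u : E d) (β : ℝ) (h : ∀ i, linearModel u (x i) * y i ≠ β) :
    gradBeta x y α η u β = deriv (fun b => risk x y α η (linearModel u) b) β := by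
  have hc : Tendsto (fun b : ℝ => (u, b)) (𝓝 β) (𝓝 (u, β)) :=
    Continuous.tendsto (by fun_prop) β
  have he : (fun b => risk x y α η (linearModel u) b) =ᶠ[𝓝 β]
      (fun b => activatedRisk x y α η (linearModel u) β (linearModel u) b) :=
    hc.eventually (risk_eventuallyEq x y α η u β h)
  exact he.deriv_eq.symm

end CompleteHinge

end

/-!
Let `γ` be the maximal margin and `z i` the signed data. The point of least norm in the polyhedron
`{u | ∀ i, β ≤ ⟪u, z i⟫}` is `(β / γ) • ubar`. The deviation `e = u_t - (β(t) / γ) • ubar` follows a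
perceptron-like recursion: its increment `v` belongs to a finite set and satisfies `⟪e, v⟫ ≤ 0`.
Indeed an active datum has `⟪e, z i⟫ ≤ 0` because `⟪ubar, z i⟫ ≥ γ`; and when the level rises, `e`
has nonnegative inner product with all support vectors, hence with `ubar`
(`IsMaxMarginSeparator.inner_nonneg`).

Such recursions are bounded by the perceptron cycling theorem (`boundedGain`). It is proved by
induction on the set of increments. Near a direction `ν` and far from the origin, the increments
orthogonal to `ν` form a smaller set, to which induction applies, while every other increment
that may occur points away from `ν` and so decreases the norm by a fixed amount
(`exists_traps_near`). Compactness of the unit sphere makes the constants uniform.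

Since the deviation is bounded and every iteration either raises the level or increases
`⟪e, ubar⟫` by at least `η γ`, the level grows linearly (`exists_le_level`). Therefore
`u_t / ‖u_t‖ - ubar` is `O(1 / t)`. The margin is Lipschitz, and `1 - ⟪u_t / ‖u_t‖, ubar⟫` is half
the square of the distance, so all three rates follow.
-/

namespace PerceptronCycling

variable {V : Type*} [NormedAddCommGroup V] [InnerProductSpace ℝ V]

/-! ### Perceptron runs with bounded gain of norm -/

/-- A perceptron step from `a` to `b`: the increment belongs to `S` and has nonpositive inner
product with the current point `a`. -/
def Step (S : Finset V) (a b : V) : Prop :=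
  b - a ∈ S ∧ inner ℝ a (b - a) ≤ 0

/-- `I` is a set of points which can only be left, by a perceptron step, to a point of norm at
most `‖a‖`. -/
def Traps (S : Finset V) (a : V) (I : Set V) : Prop :=
  ∀ b ∈ I, ∀ b', Step S b b' → b' ∈ I ∨ ‖b'‖ ≤ ‖a‖

/-- Perceptron runs with increments in `S`, started in the span of `S`, gain at most a fixed
amount of norm. -/
def BoundedGain (S : Finset V) : Prop :=
  ∃ M : ℝ, ∀ a ∈ Submodule.span ℝ (S : Set V), ∀ b,
    Relation.ReflTransGen (Step S) a b → ‖b‖ ≤ ‖a‖ + M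

/-- The supremum of the norms reachable from a point is a Lyapunov function that differs from the
norm by a bounded amount. -/
theorem BoundedGain.exists_lyapunov {S : Finset V} (h : BoundedGain S) :
    ∃ M : ℝ, 0 ≤ M ∧ ∃ Φ : V → ℝ, ∀ a ∈ Submodule.span ℝ (S : Set V),
      ‖a‖ ≤ Φ a ∧ Φ a ≤ ‖a‖ + M ∧ ∀ b, Step S a b → Φ b ≤ Φ a := by
  obtain ⟨M, hM⟩ := h
  have hM0 : 0 ≤ M := by simpa using hM 0 (Submodule.zero_mem _) 0 .refl
  refine ⟨M, hM0, fun a => sSup {r | ∃ b, Relation.ReflTransGen (Step S) a b ∧ r = ‖b‖},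
    fun a ha => ?_⟩
  have hbdd : BddAbove {r | ∃ b, Relation.ReflTransGen (Step S) a b ∧ r = ‖b‖} := by
    refine ⟨‖a‖ + M, ?_⟩
    rintro r ⟨b, hb, rfl⟩
    exact hM a ha b hb
  refine ⟨le_csSup hbdd ⟨a, .refl, rfl⟩, csSup_le ⟨_, a, .refl, rfl⟩ ?_, fun b hab => ?_⟩
  · rintro r ⟨b, hb, rfl⟩
    exact hM a ha b hb
  · refine csSup_le_csSup hbdd ⟨_, b, .refl, rfl⟩ ?_
    rintro r ⟨c, hc, rfl⟩
    exact ⟨c, hc.head hab, rfl⟩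

/-- If from every point of large norm the runs are trapped in a set of comparable norm until
they return below the initial norm, then the gain of norm is bounded. -/
theorem boundedGain_of_traps {S : Finset V} {R M : ℝ}
    (h : ∀ a ∈ Submodule.span ℝ (S : Set V), R ≤ ‖a‖ →
      ∃ I : Set V, a ∈ I ∧ Traps S a I ∧ ∀ b ∈ I, ‖b‖ ≤ ‖a‖ + M) :
    BoundedGain S := by
  obtain ⟨C, hC⟩ : ∃ C : ℝ, ∀ v ∈ S, ‖v‖ ≤ C := by
    obtain ⟨C, hC⟩ := (S.image norm).bddAbove
    exact ⟨C, fun v hv => hC (by simpa using ⟨v, hv, rfl⟩)⟩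
  refine ⟨|R| + |C| + |M|, fun a ha b hab => ?_⟩
  set B : ℝ := ‖a‖ + |R| + |C| with hB
  have key : b ∈ Submodule.span ℝ (S : Set V) ∧ (‖b‖ ≤ B ∨
      ∃ c I, ‖c‖ ≤ B ∧ Traps S c I ∧ (∀ b ∈ I, ‖b‖ ≤ ‖c‖ + M) ∧ b ∈ I) := by
    induction hab with
    | refl => exact ⟨ha, Or.inl (by rw [hB]; linarith [abs_nonneg R, abs_nonneg C])⟩
    | @tail p q _ hpq ih =>
      obtain ⟨hp, ih⟩ := ih
      refine ⟨by simpa using Submodule.add_mem _ (Submodule.subset_span hpq.1) hp, ?_⟩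
      -- A point of norm at most `B` and at least `R` is itself the base of a trapping set.
      have ih' : ‖p‖ < R ∨
          ∃ c I, ‖c‖ ≤ B ∧ Traps S c I ∧ (∀ b ∈ I, ‖b‖ ≤ ‖c‖ + M) ∧ p ∈ I := by
        rcases ih with hpB | h'
        · rcases lt_or_ge ‖p‖ R with hlt | hge
          · exact Or.inl hlt
          · obtain ⟨I, h1, h2, h3⟩ := h p hp hge
            exact Or.inr ⟨p, I, hpB, h2, h3, h1⟩
        · exact Or.inr h'
      rcases ih' with hlt | ⟨c, I, hc, hT, hI, hpI⟩
      · left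
        have h1 : ‖q‖ ≤ ‖p‖ + ‖q - p‖ := by
          simpa using norm_add_le p (q - p)
        have h2 := hC _ hpq.1
        rw [hB]
        linarith [norm_nonneg a, le_abs_self R, le_abs_self C]
      · rcases hT p hpI q hpq with hq | hq
        · exact Or.inr ⟨c, I, hc, hT, hI, hq⟩
        · exact Or.inl (hq.trans hc)
  rcases key.2 with hb | ⟨c, I, hc, -, hI, hbI⟩
  · linarith [abs_nonneg M]
  · linarith [hI b hbI, le_abs_self M]

/-! ### Runs near a fixed direction -/

/-- Growth by `M + K * x` of a short component is outweighed, up to a term linear in `R`, by the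
loss `x` of a long one. -/
theorem sq_add_sq_le_of_loss {p₀ q₀ p R M K θ δ x : ℝ} (hM : 0 ≤ M) (hK : 1 ≤ K) (hR : 1 ≤ R)
    (hp₀ : p₀ ≤ δ * R) (hq₀ : R * (3 / 4) ≤ q₀) (hp0 : 0 ≤ p) (hp : p ≤ p₀ + (M + K * x))
    (hx0 : 0 ≤ x) (hx : x ≤ 2 * θ * R) (hδ : δ ≤ 1 / 32) (hδK : δ * K ≤ 1 / 32)
    (hθK : θ * K ^ 2 ≤ 1 / 128) :
    p ^ 2 + (q₀ - x) ^ 2 ≤ p₀ ^ 2 + q₀ ^ 2 + (M + 2 * M ^ 2) * R - R * x / 2 := by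
  have hy : 0 ≤ M + K * x := by positivity
  have hp2 : p ^ 2 ≤ (p₀ + (M + K * x)) ^ 2 := pow_le_pow_left₀ hp0 hp 2
  have hRM : 0 ≤ R * M := by positivity
  have hRx : 0 ≤ R * x := by positivity
  have e1 : p₀ * (M + K * x) ≤ δ * R * (M + K * x) := mul_le_mul_of_nonneg_right hp₀ hy
  have e2 : δ * R * (M + K * x) ≤ R * M / 32 + R * x / 32 := by
    have h1 := mul_le_mul_of_nonneg_right hδ hRM
    have h2 := mul_le_mul_of_nonneg_right hδK hRx
    linarith
  have e3 : (M + K * x) ^ 2 ≤ 2 * M ^ 2 + 2 * (K ^ 2 * x ^ 2) := by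
    linarith [sq_nonneg (M - K * x)]
  have e4 : K ^ 2 * x ^ 2 ≤ R * x / 64 := by
    have h1 : K ^ 2 * x ^ 2 ≤ K ^ 2 * (x * (2 * θ * R)) := by
      rw [sq x]
      exact mul_le_mul_of_nonneg_left (mul_le_mul_of_nonneg_left hx hx0) (by positivity)
    have h3 := mul_le_mul_of_nonneg_right hθK hRx
    linarith
  have e5 : x ^ 2 ≤ K ^ 2 * x ^ 2 := le_mul_of_one_le_left (sq_nonneg x) (one_le_pow₀ hK)
  have e6 : R * (3 / 4) * x ≤ q₀ * x := mul_le_mul_of_nonneg_right hq₀ hx0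
  have e7 : M ^ 2 ≤ M ^ 2 * R := le_mul_of_one_le_right (sq_nonneg M) hR
  linarith

/-- Near the ray through `ν`, an increment that points away from `ν` shortens the vector. -/
theorem norm_add_le_norm_sub {ν q h : V} {c C ρ R : ℝ} (hc : 0 < c) (hR : 0 ≤ R)
    (hρ : ρ * C = c / 4) (hν : inner ℝ ν h ≤ -c) (hh : ‖h‖ ≤ C) (hq : ‖q - R • ν‖ ≤ ρ * R)
    (hqR : ‖q‖ ≤ R) (hqc : c / 8 ≤ ‖q‖) (hCR : 16 * C ^ 2 ≤ R * c) :
    ‖q + h‖ ≤ ‖q‖ - c / 8 := by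
  have h1 : inner ℝ q h = R * inner ℝ ν h + inner ℝ (q - R • ν) h := by
    rw [inner_sub_left, real_inner_smul_left]; ring
  have h2 : inner ℝ (q - R • ν) h ≤ ρ * R * C :=
    (real_inner_le_norm _ _).trans
      (mul_le_mul hq hh (norm_nonneg _) ((norm_nonneg _).trans hq))
  have h2' : ρ * R * C = R * (c / 4) := by rw [← hρ]; ring
  have h3 : R * inner ℝ ν h ≤ R * -c := mul_le_mul_of_nonneg_left hν hR
  have h4 : ‖h‖ ^ 2 ≤ C ^ 2 := pow_le_pow_left₀ (norm_nonneg _) hh 2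
  have h5 : c * ‖q‖ ≤ c * R := mul_le_mul_of_nonneg_left hqR hc.le
  have h6 : 0 ≤ R * c := by positivity
  refine (sq_le_sq₀ (norm_nonneg _) (by linarith)).1 ?_
  rw [norm_add_sq_real]
  linarith [sq_nonneg c]

/-- The constants used in `exists_traps_near`: `K` converts a loss of norm into the displacement
it pays for, `ρ` is the aperture of the cone around `ν` in which the increments not orthogonal
to `ν` keep the sign of their inner product, `θ` is the relative loss after which a run is
abandoned, `δ` is the size of the neighbourhood, and `R₀` bounds the initial norm from below. -/
theorem exists_trap_constants {c C M : ℝ} (hc0 : 0 < c) (hc1 : c ≤ 1) (hC1 : 1 ≤ C)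
    (hM0 : 0 ≤ M) :
    ∃ K ρ θ δ R₀ : ℝ, 8 ≤ K ∧ 0 < ρ ∧ 0 < θ ∧ 0 < δ ∧ K * (c / 8) = C + M ∧ ρ * C = c / 4 ∧
      ρ ≤ 1 / 4 ∧ θ * K ^ 2 ≤ 1 / 128 ∧ K * θ ≤ ρ / 8 ∧ δ * K = ρ / 8 ∧ δ ≤ ρ / 8 ∧
      ∀ R, R₀ ≤ R → 1 ≤ R ∧ 16 * C ^ 2 ≤ R * c ∧ 8 * M ≤ R * ρ ∧ C ≤ R * θ ∧
        8 * (M + M ^ 2) ≤ R * θ := by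
  have hC0 : 0 < C := by linarith
  obtain ⟨K, hK⟩ : ∃ K, K = 8 * (C + M) / c := ⟨_, rfl⟩
  obtain ⟨ρ, hρ⟩ : ∃ ρ, ρ = c / (4 * C) := ⟨_, rfl⟩
  have hρ0 : 0 < ρ := by rw [hρ]; positivity
  have hK0 : 8 ≤ K := by
    rw [hK, le_div_iff₀ hc0]; linarith
  have hKpos : 0 < K := by linarith
  have hρ1 : ρ ≤ 1 / 4 := by
    rw [hρ, div_le_iff₀ (by positivity)]; linarith
  have hθ0 : 0 < ρ / (32 * K ^ 2) := by positivity
  refine ⟨K, ρ, ρ / (32 * K ^ 2), ρ / (8 * K),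
    max (max 1 (16 * C ^ 2 / c)) (max (8 * M / ρ) (max (C / (ρ / (32 * K ^ 2)))
      (8 * (M + M ^ 2) / (ρ / (32 * K ^ 2))))),
    hK0, hρ0, hθ0, by positivity, by rw [hK]; field_simp, by rw [hρ]; field_simp, hρ1, ?_, ?_,
    by field_simp, ?_, fun R hR => ?_⟩
  · field_simp; linarith
  · have : K * (ρ / (32 * K ^ 2)) = ρ / (32 * K) := by field_simp
    rw [this]
    exact div_le_div_of_nonneg_left hρ0.le (by norm_num) (by linarith)
  · exact div_le_div_of_nonneg_left hρ0.le (by norm_num) (by linarith)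
  · simpa only [max_le_iff, div_le_iff₀ hc0, div_le_iff₀ hρ0, div_le_iff₀ hθ0, and_assoc] using hR

set_option maxHeartbeats 1000000 in
/-- Trapping sets near a direction `ν`. Let `T` be the set of increments orthogonal to `ν`. At
points near the ray through `ν` every other possible increment points away from `ν`, hence
shortens the component orthogonal to `span T`; this loss pays for the growth of the component
in `span T`, where the increments from `T` are controlled by the Lyapunov function. -/
theorem exists_traps_near {S T : Finset V} {ν : V} (hν : ‖ν‖ = 1)
    (hT : ∀ v, v ∈ T ↔ v ∈ S ∧ inner ℝ ν v = 0) (h : BoundedGain T) :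
    ∃ δ > 0, ∃ R M : ℝ, ∀ a : V, R ≤ ‖a‖ → ‖a - ‖a‖ • ν‖ ≤ δ * ‖a‖ →
      ∃ I : Set V, a ∈ I ∧ Traps S a I ∧ ∀ b ∈ I, ‖b‖ ≤ ‖a‖ + M := by
  obtain ⟨M, hM0, Φ, hΦ⟩ := h.exists_lyapunov
  obtain ⟨C, hC1, hC⟩ : ∃ C : ℝ, 1 ≤ C ∧ ∀ v ∈ S, ‖v‖ ≤ C := by
    obtain ⟨C, hC⟩ := (S.image norm).bddAbove
    exact ⟨max 1 C, le_max_left _ _,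
      fun v hv => (hC (by simpa using ⟨v, hv, rfl⟩)).trans (le_max_right _ _)⟩
  obtain ⟨c, hc0, hc1, hc⟩ : ∃ c : ℝ, 0 < c ∧ c ≤ 1 ∧ ∀ v ∈ S, v ∉ T → c ≤ |inner ℝ ν v| := by
    have key : ∀ s : Finset V, (∀ v ∈ s, (inner ℝ ν v : ℝ) ≠ 0) →
        ∃ c : ℝ, 0 < c ∧ c ≤ 1 ∧ ∀ v ∈ s, c ≤ |inner ℝ ν v| := by
      classical
      intro s
      induction s using Finset.induction_on with
      | empty => exact fun _ => ⟨1, one_pos, le_rfl, by simp⟩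
      | insert w s _ ih =>
        intro hs
        obtain ⟨c, h0, h1, h2⟩ := ih fun v hv => hs v (Finset.mem_insert_of_mem hv)
        refine ⟨min c |inner ℝ ν w|, lt_min h0 (abs_pos.2 (hs w (Finset.mem_insert_self _ _))),
          (min_le_left _ _).trans h1, fun v hv => ?_⟩
        rcases Finset.mem_insert.1 hv with rfl | hv
        · exact min_le_right _ _
        · exact (min_le_left _ _).trans (h2 v hv)
    classical
    obtain ⟨c, h0, h1, h2⟩ := key (S.filter (· ∉ T)) fun v hv h0 => by
      rw [Finset.mem_filter] at hv
      exact hv.2 ((hT v).2 ⟨hv.1, h0⟩)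
    exact ⟨c, h0, h1, fun v hv hv' => h2 v (Finset.mem_filter.2 ⟨hv, hv'⟩)⟩
  set F : Submodule ℝ V := Submodule.span ℝ (T : Set V) with hF
  set P : V →L[ℝ] V := F.starProjection with hP
  set Q : V →L[ℝ] V := Fᗮ.starProjection with hQ
  have hPQ : ∀ w, P w + Q w = w := fun w => F.starProjection_add_starProjection_orthogonal w
  have hPn : ∀ w, ‖P w‖ ≤ ‖w‖ := fun w => F.norm_starProjection_apply_le w
  have hQn : ∀ w, ‖Q w‖ ≤ ‖w‖ := fun w => Fᗮ.norm_starProjection_apply_le w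
  have hPF : ∀ w, P w ∈ F := fun w => F.starProjection_apply_mem w
  have hpyth : ∀ w, ‖w‖ ^ 2 = ‖P w‖ ^ 2 + ‖Q w‖ ^ 2 := fun w => by
    exact Submodule.norm_sq_eq_add_norm_sq_starProjection w F
  have hνF : ν ∈ Fᗮ := by
    rw [Submodule.mem_orthogonal]
    intro w hw
    induction hw using Submodule.span_induction with
    | mem v hv => rw [real_inner_comm]; exact ((hT v).1 hv).2
    | zero => simp
    | add v w _ _ h1 h2 => rw [inner_add_left, h1, h2, add_zero]
    | smul r v _ h1 => rw [real_inner_smul_left, h1, mul_zero]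
  have hQν : Q ν = ν := Submodule.starProjection_eq_self_iff.2 hνF
  have hPν : P ν = 0 := by simpa [hQν] using hPQ ν
  have hPT : ∀ v ∈ T, P v = v := fun v hv =>
    Submodule.starProjection_eq_self_iff.2 (Submodule.subset_span hv)
  have hQT : ∀ v ∈ T, Q v = 0 := fun v hv => by simpa [hPT v hv] using hPQ v
  have hQF : ∀ w, Q w ∈ Fᗮ := fun w => Fᗮ.starProjection_apply_mem w
  clear_value P Q
  obtain ⟨K, ρ, θ, δ, R₀, hK0, hρ0, hθ0, hδ0, hKc, hρC, hρ1, hθK, hθρ, hδK, hδρ, hR₀⟩ :=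
    exists_trap_constants hc0 hc1 hC1 hM0
  refine ⟨δ, hδ0, R₀, M + 2 * M ^ 2, fun a haR haν => ?_⟩
  set R : ℝ := ‖a‖ with hR
  clear_value R
  obtain ⟨hR5, hR1', hR2', hR3', hR4'⟩ := hR₀ R haR
  have hPa : ‖P a‖ ≤ δ * R := by
    have : P (a - R • ν) = P a := by rw [map_sub, map_smul, hPν, smul_zero, sub_zero]
    rw [← this]; exact (hPn _).trans haν
  have hQa : ‖Q a - R • ν‖ ≤ δ * R := by
    have : Q (a - R • ν) = Q a - R • ν := by rw [map_sub, map_smul, hQν]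
    rw [← this]; exact (hQn _).trans haν
  have hQa' : R * (3 / 4) ≤ ‖Q a‖ := by
    have h1 : ‖R • ν‖ ≤ ‖Q a‖ + ‖Q a - R • ν‖ := by
      have := norm_sub_le (Q a) (Q a - R • ν)
      rwa [sub_sub_cancel] at this
    rw [norm_smul, hν, Real.norm_of_nonneg (by linarith), mul_one] at h1
    nlinarith
  -- The norm along a run is controlled by the loss `‖Q a‖ - ‖Q b‖`.
  have hnorm : ∀ b, 0 ≤ ‖Q a‖ - ‖Q b‖ → ‖Q a‖ - ‖Q b‖ ≤ 2 * θ * R →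
      Φ (P b) ≤ Φ (P a) + K * (‖Q a‖ - ‖Q b‖) →
      ‖b‖ ^ 2 ≤ R ^ 2 + (M + 2 * M ^ 2) * R - R * (‖Q a‖ - ‖Q b‖) / 2 := by
    intro b hx0 hx1 hΦb
    have hPb : ‖P b‖ ≤ ‖P a‖ + (M + K * (‖Q a‖ - ‖Q b‖)) := by
      linarith [(hΦ (P b) (hPF b)).1, (hΦ (P a) (hPF a)).2.1]
    have key := sq_add_sq_le_of_loss hM0 (by linarith) hR5 hPa hQa' (norm_nonneg _) hPb hx0 hx1
      (by linarith) (by linarith) hθK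
    rwa [sub_sub_cancel, ← hpyth, ← hpyth, ← hR] at key
  refine ⟨{b | 0 ≤ ‖Q a‖ - ‖Q b‖ ∧ ‖Q a‖ - ‖Q b‖ ≤ θ * R ∧
      ‖Q b - Q a‖ ≤ K * (‖Q a‖ - ‖Q b‖) ∧ Φ (P b) ≤ Φ (P a) + K * (‖Q a‖ - ‖Q b‖)},
    ⟨by simp, by rw [sub_self]; positivity, by simp, by simp⟩, ?_, ?_⟩
  · rintro b ⟨hx0, hx1, hQb, hΦb⟩ b' ⟨hvS, hbv⟩
    obtain ⟨v, hv⟩ : ∃ v, v = b' - b := ⟨_, rfl⟩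
    rw [← hv] at hvS hbv
    obtain rfl : b' = b + v := by rw [hv]; abel
    have hPbv : P (b + v) = P b + P v := map_add _ _ _
    have hQbv : Q (b + v) = Q b + Q v := map_add _ _ _
    by_cases hvT : v ∈ T
    · left
      rw [Set.mem_ofPred_eq, hQbv, hQT v hvT, add_zero]
      refine ⟨hx0, hx1, hQb, le_trans ?_ hΦb⟩
      refine (hΦ (P b) (hPF b)).2.2 _ ?_
      rw [Step, hPbv, add_sub_cancel_left, hPT v hvT]
      refine ⟨hvT, ?_⟩
      have h1 : inner ℝ b v = inner ℝ (P b) v + inner ℝ (Q b) v := by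
        rw [← inner_add_left, hPQ]
      have h2 : inner ℝ (Q b) v = 0 :=
        Submodule.inner_left_of_mem_orthogonal (Submodule.subset_span hvT)
          (hQF b)
      linarith
    · have hvC := hC v hvS
      have hKx : K * (‖Q a‖ - ‖Q b‖) ≤ ρ / 8 * R := by
        have h1 := mul_le_mul_of_nonneg_left hx1 (by linarith : (0 : ℝ) ≤ K)
        have h2 := mul_le_mul_of_nonneg_right hθρ (by linarith : (0 : ℝ) ≤ R)
        linarith
      have hδR : δ * R ≤ ρ / 8 * R := mul_le_mul_of_nonneg_right hδρ (by linarith)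
      have hPb : ‖P b‖ ≤ ρ / 8 * R + M + ρ / 8 * R := by
        linarith [(hΦ (P b) (hPF b)).1, (hΦ (P a) (hPF a)).2.1]
      have hQbν : ‖Q b - R • ν‖ ≤ ρ / 8 * R + ρ / 8 * R := by
        have := norm_add_le (Q b - Q a) (Q a - R • ν)
        rw [sub_add_sub_cancel] at this
        linarith
      have hbν : ‖b - R • ν‖ ≤ ρ * R := by
        have := norm_add_le (P b) (Q b - R • ν)
        rw [← add_sub_assoc, hPQ] at this
        linarith
      have hQbR : ‖Q b‖ ≤ R := by linarith [hQn a]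
      have hθ1 : θ * R ≤ 1 / 128 * R :=
        mul_le_mul_of_nonneg_right (by nlinarith) (by linarith)
      have hνv : inner ℝ ν v ≤ -c := by
        have h1 : inner ℝ b v = R * inner ℝ ν v + inner ℝ (b - R • ν) v := by
          rw [inner_sub_left, real_inner_smul_left]; ring
        have h2 : |inner ℝ (b - R • ν) v| ≤ ρ * R * C :=
          (abs_real_inner_le_norm _ _).trans
            (mul_le_mul hbν hvC (norm_nonneg _) ((norm_nonneg _).trans hbν))
        have h2' : ρ * R * C = R * (c / 4) := by
          rw [show c / 4 = ρ * C from hρC.symm]; ring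
        have h3 : R * inner ℝ ν v ≤ R * (c / 4) := by linarith [(abs_le.1 h2).1]
        have h4 := le_of_mul_le_mul_left h3 (by linarith)
        rcases le_abs'.1 (hc v hvS hvT) with h | h <;> linarith
      have hνQv : inner ℝ ν (Q v) = inner ℝ ν v := by
        have h1 : inner ℝ ν v = inner ℝ ν (P v) + inner ℝ ν (Q v) := by
          rw [← inner_add_right, hPQ]
        rw [h1, Submodule.inner_left_of_mem_orthogonal (hPF v) hνF, zero_add]
      have hdrop : ‖Q (b + v)‖ ≤ ‖Q b‖ - c / 8 := by
        rw [hQbv]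
        have h0 : 0 ≤ ρ * R := by positivity
        exact norm_add_le_norm_sub hc0 (by linarith) hρC (hνQv.trans_le hνv)
          ((hQn v).trans hvC) (by linarith) hQbR (by linarith) hR1'
      have hloss : ‖Q b‖ ≤ ‖Q (b + v)‖ + C := by
        have h1 := norm_sub_le (Q b + Q v) (Q v)
        rw [add_sub_cancel_right, ← hQbv] at h1
        linarith [hQn v]
      have hKd := mul_le_mul_of_nonneg_left hdrop (by linarith : (0 : ℝ) ≤ K)
      rw [mul_sub, hKc] at hKd
      have hQ' : ‖Q (b + v) - Q a‖ ≤ K * (‖Q a‖ - ‖Q (b + v)‖) := by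
        have h1 := norm_add_le (Q b - Q a) (Q v)
        rw [sub_add_eq_add_sub, ← hQbv] at h1
        linarith [hQn v]
      have hΦ' : Φ (P (b + v)) ≤ Φ (P a) + K * (‖Q a‖ - ‖Q (b + v)‖) := by
        have h1 := norm_add_le (P b) (P v)
        rw [← hPbv] at h1
        linarith [hPn v, (hΦ (P b) (hPF b)).1, (hΦ _ (hPF (b + v))).2.1]
      rcases le_or_gt (‖Q a‖ - ‖Q (b + v)‖) (θ * R) with hle | hgt
      · exact Or.inl ⟨by linarith, hle, hQ', hΦ'⟩
      · right
        have h1 := hnorm (b + v) (by linarith) (by linarith) hΦ'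
        have h2 : R * (8 * (M + M ^ 2)) ≤ R * (‖Q a‖ - ‖Q (b + v)‖) :=
          mul_le_mul_of_nonneg_left (by linarith) (by linarith)
        have h3 : 0 ≤ R * M := by positivity
        have h4 : 0 ≤ R * M ^ 2 := by positivity
        rw [← hR]
        refine (sq_le_sq₀ (norm_nonneg _) (by linarith)).1 ?_
        linarith
  · rintro b ⟨hx0, hx1, -, hΦb⟩
    have h0 : 0 ≤ θ * R := by positivity
    have h1 := hnorm b hx0 (by linarith) hΦb
    have h2 : 0 ≤ R * (‖Q a‖ - ‖Q b‖) := mul_nonneg (by linarith) hx0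
    have h3 : 0 ≤ (M + 2 * M ^ 2) * R := by positivity
    refine (sq_le_sq₀ (norm_nonneg _) (by positivity)).1 ?_
    linarith [sq_nonneg (M + 2 * M ^ 2)]

/-! ### The perceptron cycling theorem -/

/-- The perceptron cycling theorem, in uniform form. -/
theorem boundedGain [FiniteDimensional ℝ V] (S : Finset V) : BoundedGain S := by
  classical
  induction S using Finset.strongInduction with
  | H S ih =>
    set F : Submodule ℝ V := Submodule.span ℝ (S : Set V) with hF
    have hcomp : IsCompact (Metric.sphere (0 : V) 1 ∩ F) :=
      (isCompact_sphere 0 1).inter_right F.closed_of_finiteDimensional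
    obtain ⟨R, M, h⟩ : ∃ R M : ℝ, ∀ a : V, R ≤ ‖a‖ →
        ‖a‖⁻¹ • a ∈ Metric.sphere (0 : V) 1 ∩ F →
        ∃ I : Set V, a ∈ I ∧ Traps S a I ∧ ∀ b ∈ I, ‖b‖ ≤ ‖a‖ + M := by
      refine hcomp.induction_on (p := fun s => ∃ R M : ℝ, ∀ a : V, R ≤ ‖a‖ → ‖a‖⁻¹ • a ∈ s →
        ∃ I : Set V, a ∈ I ∧ Traps S a I ∧ ∀ b ∈ I, ‖b‖ ≤ ‖a‖ + M) ?_ ?_ ?_ ?_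
      · exact ⟨0, 0, by simp⟩
      · rintro s t hst ⟨R, M, h⟩
        exact ⟨R, M, fun a ha has => h a ha (hst has)⟩
      · rintro s t ⟨R₁, M₁, h₁⟩ ⟨R₂, M₂, h₂⟩
        refine ⟨max R₁ R₂, max M₁ M₂, fun a ha has => ?_⟩
        rcases has with has | has
        · obtain ⟨I, i1, i2, i3⟩ := h₁ a ((le_max_left _ _).trans ha) has
          exact ⟨I, i1, i2, fun b hb => (i3 b hb).trans (by gcongr; exact le_max_left _ _)⟩
        · obtain ⟨I, i1, i2, i3⟩ := h₂ a ((le_max_right _ _).trans ha) has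
          exact ⟨I, i1, i2, fun b hb => (i3 b hb).trans (by gcongr; exact le_max_right _ _)⟩
      · rintro ν ⟨hν1, hνF⟩
        have hν : ‖ν‖ = 1 := by simpa using hν1
        -- A unit vector in the span of `S` is not orthogonal to all of `S`.
        have hss : S.filter (fun v => inner ℝ ν v = 0) ⊂ S := by
          refine Finset.filter_ssubset.2 ?_
          by_contra! hall
          have : ∀ w ∈ F, inner ℝ ν w = 0 := by
            intro w hw
            induction hw using Submodule.span_induction with
            | mem v hv => exact hall v hv
            | zero => simp
            | add v w _ _ h1 h2 => rw [inner_add_right, h1, h2, add_zero]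
            | smul r v _ h1 => rw [real_inner_smul_right, h1, mul_zero]
          have h0 := this ν hνF
          rw [real_inner_self_eq_norm_sq, hν] at h0
          norm_num at h0
        obtain ⟨δ, hδ, R, M, h⟩ := exists_traps_near hν (fun v => Finset.mem_filter) (ih _ hss)
        refine ⟨Metric.ball ν δ, mem_nhdsWithin_of_mem_nhds (Metric.ball_mem_nhds ν hδ),
          max R 1, M, fun a ha haν => h a ((le_max_left _ _).trans ha) ?_⟩
        have ha0 : ‖a‖ ≠ 0 := by linarith [(le_max_right R 1).trans ha]
        have e : a - ‖a‖ • ν = ‖a‖ • (‖a‖⁻¹ • a - ν) := by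
          rw [smul_sub, smul_inv_smul₀ ha0]
        rw [e, norm_smul, norm_norm, mul_comm]
        rw [Metric.mem_ball, dist_eq_norm] at haν
        exact mul_le_mul_of_nonneg_right haν.le (norm_nonneg _)
    refine boundedGain_of_traps (R := max R 1) (M := M) fun a ha haR => ?_
    have ha0 : ‖a‖ ≠ 0 := by linarith [(le_max_right R 1).trans haR]
    refine h a ((le_max_left _ _).trans haR) ⟨?_, F.smul_mem _ ha⟩
    rw [mem_sphere_zero_iff_norm, norm_smul, norm_inv, norm_norm, inv_mul_cancel₀ ha0]

end PerceptronCycling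

namespace CompleteHinge

open PerceptronCycling

/-! ### The margin and its maximizer -/

section Margin

variable {d n : ℕ} {z : Fin n → E d}

theorem margin_le (z : Fin n → E d) (u : E d) (i : Fin n) : margin z u ≤ inner ℝ u (z i) :=
  ciInf_le (Set.finite_range _).bddBelow i

theorem le_margin_iff [Nonempty (Fin n)] {u : E d} {r : ℝ} :
    r ≤ margin z u ↔ ∀ i, r ≤ inner ℝ u (z i) :=
  le_ciInf_iff (Set.finite_range _).bddBelow

theorem abs_margin_sub_le [Nonempty (Fin n)] (u v : E d) :
    |margin z u - margin z v| ≤ (∑ i, ‖z i‖) * ‖u - v‖ := by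
  have key : ∀ u v : E d, margin z v - (∑ i, ‖z i‖) * ‖u - v‖ ≤ margin z u := by
    intro u v
    refine le_margin_iff.2 fun i => ?_
    have h1 := margin_le z v i
    have h2 : inner ℝ v (z i) = inner ℝ u (z i) - inner ℝ (u - v) (z i) := by
      rw [inner_sub_left]; ring
    have h3 : -(‖u - v‖ * ‖z i‖) ≤ inner ℝ (u - v) (z i) :=
      (abs_le.1 (abs_real_inner_le_norm _ _)).1
    have h4 : ‖z i‖ * ‖u - v‖ ≤ (∑ i, ‖z i‖) * ‖u - v‖ :=
      mul_le_mul_of_nonneg_right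
        (Finset.single_le_sum (f := fun i => ‖z i‖) (fun j _ => norm_nonneg _)
          (Finset.mem_univ i)) (norm_nonneg _)
    linarith
  have h1 := key u v
  have h2 := key v u
  rw [norm_sub_rev] at h2
  rw [abs_le]
  constructor <;> linarith

theorem margin_smul [Nonempty (Fin n)] {r : ℝ} (hr : 0 ≤ r) (u : E d) :
    r * margin z u ≤ margin z (r • u) := by
  refine le_margin_iff.2 fun i => ?_
  rw [real_inner_smul_left]
  exact mul_le_mul_of_nonneg_left (margin_le z u i) hr

variable {ubar : E d}

theorem IsMaxMarginSeparator.margin_eq (h : IsMaxMarginSeparator z ubar) :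
    margin z ubar = maxMargin z := by
  have hg : IsGreatest (margin z '' Metric.sphere (0 : E d) 1) (margin z ubar) := by
    refine ⟨⟨ubar, by simp [h.norm_eq_one], rfl⟩, ?_⟩
    rintro _ ⟨u, hu, rfl⟩
    exact h.le_margin u (by simpa using hu)
  exact hg.csSup_eq.symm

theorem IsMaxMarginSeparator.margin_le_mul_norm [Nonempty (Fin n)]
    (h : IsMaxMarginSeparator z ubar) {u : E d} (hu : u ≠ 0) :
    margin z u ≤ maxMargin z * ‖u‖ := by
  have hu' : 0 < ‖u‖ := norm_pos_iff.2 hu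
  have h1 : margin z (‖u‖⁻¹ • u) ≤ maxMargin z := by
    rw [← h.margin_eq]
    exact h.le_margin _ (by rw [norm_smul, norm_inv, norm_norm, inv_mul_cancel₀ hu'.ne'])
  have h2 := (margin_smul (z := z) (inv_nonneg.2 hu'.le) u).trans h1
  rwa [inv_mul_eq_div, div_le_iff₀ hu'] at h2

theorem maxMargin_pos [Nonempty (Fin n)] (h : IsMaxMarginSeparator z ubar)
    (hsep : LinearlySeparable z) : 0 < maxMargin z := by
  obtain ⟨w, hw⟩ := hsep
  obtain ⟨i, hi⟩ := exists_eq_ciInf_of_finite (f := fun i => inner ℝ w (z i))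
  have hm : 0 < margin z w := by rw [margin, ← hi]; exact hw i
  have hw0 : w ≠ 0 := by
    rintro rfl
    simpa using hw i
  exact pos_of_mul_pos_left (hm.trans_le (h.margin_le_mul_norm hw0)) (norm_nonneg _)

/-- First-order optimality: the max-margin separator lies in the cone generated by the support
vectors, stated in dual form. Otherwise moving `ubar` slightly in the direction `e` would
decrease its norm without decreasing its margin. -/
theorem IsMaxMarginSeparator.inner_nonneg [Nonempty (Fin n)] (h : IsMaxMarginSeparator z ubar)
    (hγ : 0 < maxMargin z) {e : E d}
    (he : ∀ s ∈ supportVectors z ubar, 0 ≤ inner ℝ e s) : 0 ≤ inner ℝ e ubar := by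
  by_contra! hneg
  -- For small `r > 0` the margin constraints persist and the norm decreases.
  have hmargin : ∀ᶠ r in 𝓝[>] (0 : ℝ), ∀ i, maxMargin z ≤ inner ℝ (ubar + r • e) (z i) := by
    refine eventually_all.2 fun i => ?_
    have hi : maxMargin z ≤ inner ℝ ubar (z i) := h.margin_eq ▸ margin_le z ubar i
    rcases hi.eq_or_lt with heq | hlt
    · filter_upwards [self_mem_nhdsWithin] with r hr
      rw [inner_add_left, real_inner_smul_left]
      have h1 := mul_nonneg (le_of_lt hr) (he (z i) ⟨⟨i, rfl⟩, heq.symm⟩)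
      linarith
    · have hc : ContinuousAt (fun r : ℝ => (inner ℝ (ubar + r • e) (z i) : ℝ)) 0 := by fun_prop
      have h0 : maxMargin z < inner ℝ (ubar + (0 : ℝ) • e) (z i) := by simpa using hlt
      filter_upwards [nhdsWithin_le_nhds (hc.eventually_const_lt h0)] with r hr
      exact le_of_lt hr
  have hnorm : ∀ᶠ r in 𝓝[>] (0 : ℝ), ‖ubar + r • e‖ < 1 := by
    have hc : ContinuousAt (fun r : ℝ => 2 * inner ℝ e ubar + r * ‖e‖ ^ 2) 0 := by fun_prop
    have h0 : 2 * inner ℝ e ubar + (0 : ℝ) * ‖e‖ ^ 2 < 0 := by linarith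
    filter_upwards [nhdsWithin_le_nhds (hc.eventually_lt_const h0), self_mem_nhdsWithin]
      with r hr hr0
    have h1 : ‖ubar + r • e‖ ^ 2 = 1 + r * (2 * inner ℝ e ubar + r * ‖e‖ ^ 2) := by
      rw [norm_add_sq_real, h.norm_eq_one, real_inner_smul_right, norm_smul,
        Real.norm_of_nonneg (le_of_lt hr0), real_inner_comm]
      ring
    have h2 := mul_neg_of_pos_of_neg (Set.mem_Ioi.1 hr0) hr
    exact (sq_lt_one_iff₀ (norm_nonneg _)).1 (by linarith)
  obtain ⟨r, hr1, hr2⟩ := (hmargin.and hnorm).exists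
  have hne : ubar + r • e ≠ 0 := by
    intro h0
    obtain ⟨i⟩ := ‹Nonempty (Fin n)›
    have := hr1 i
    rw [h0, inner_zero_left] at this
    linarith
  have h1 := (le_margin_iff.2 hr1).trans (h.margin_le_mul_norm hne)
  have h2 := mul_lt_mul_of_pos_left hr2 hγ
  linarith

end Margin

/-! ### Gradient descent on the complete hinge loss -/

section Iterates

variable {d n : ℕ}

/-- The deviation of the parameter `u` from the point `(β / γ) • ubar`, which is the point of
least norm in the polyhedron `{u | ∀ i, β ≤ ⟪u, z i⟫}`. -/
noncomputable def deviation (z : Fin n → E d) (ubar : E d) (p : E d × ℝ) : E d :=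
  p.1 - (p.2 / maxMargin z) • ubar

/-- The possible increments of the deviation: the data of an arbitrary subset are added, and the
level is raised or not. -/
noncomputable def increments (z : Fin n → E d) (ubar : E d) (α η : ℝ) : Finset (E d) := by
  classical
  exact (Finset.univ : Finset (Finset (Fin n) × Bool)).image fun A =>
    η • ∑ i ∈ A.1, z i - (if A.2 then α / maxMargin z else 0) • ubar

variable {x : Fin n → E d} {y : Fin n → ℝ} {ubar : E d} {α η : ℝ}

open Classical in
theorem iterate_succ_fst (u₀ : E d) (t : ℕ) :
    (iterate x y α η u₀ (t + 1)).1 = (iterate x y α η u₀ t).1 +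
      η • ∑ i with inner ℝ (iterate x y α η u₀ t).1 (signedData x y i) ≤ (iterate x y α η u₀ t).2,
        signedData x y i := by
  rw [iterate, gradU_eq, smul_neg, sub_neg_eq_add, Finset.sum_filter]
  simp only [ite_smul, one_smul, zero_smul]

open Classical in
theorem iterate_succ_snd (hη : 0 < η) (u₀ : E d) (t : ℕ) :
    (iterate x y α η u₀ (t + 1)).2 = (iterate x y α η u₀ t).2 +
      if ∀ i, (iterate x y α η u₀ t).2 ≤ inner ℝ (iterate x y α η u₀ t).1 (signedData x y i)
        then α else 0 := by
  rw [iterate, gradBeta_eq]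
  split_ifs
  · field_simp; ring
  · simp

theorem iterate_snd_nonneg (hη : 0 < η) (hα : 0 < α) (u₀ : E d) (t : ℕ) :
    0 ≤ (iterate x y α η u₀ t).2 := by
  induction t with
  | zero => exact le_rfl
  | succ t ih =>
    rw [iterate_succ_snd hη]
    split_ifs <;> linarith

open Classical in
theorem deviation_succ_sub (hη : 0 < η) (u₀ : E d) (t : ℕ) :
    deviation (signedData x y) ubar (iterate x y α η u₀ (t + 1))
      - deviation (signedData x y) ubar (iterate x y α η u₀ t) =
    η • ∑ i with inner ℝ (iterate x y α η u₀ t).1 (signedData x y i) ≤ (iterate x y α η u₀ t).2,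
        signedData x y i
      - (if ∀ i, (iterate x y α η u₀ t).2 ≤ inner ℝ (iterate x y α η u₀ t).1 (signedData x y i)
        then α / maxMargin (signedData x y) else 0) • ubar := by
  rw [deviation, deviation, iterate_succ_fst, iterate_succ_snd hη]
  split_ifs
  · rw [add_div, add_smul]; abel
  · rw [add_zero, zero_smul]; abel

/-- The deviations form a perceptron run. An active datum has nonpositive inner product with the
deviation because `ubar` has margin `γ`, and when the level is raised the deviation has
nonnegative inner product with the support vectors, hence with `ubar`. -/
theorem step_deviation [Nonempty (Fin n)]
    (h : IsMaxMarginSeparator (signedData x y) ubar)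
    (hγ : 0 < maxMargin (signedData x y)) (hη : 0 < η) (hα : 0 < α) (u₀ : E d) (t : ℕ) :
    Step (increments (signedData x y) ubar α η)
      (deviation (signedData x y) ubar (iterate x y α η u₀ t))
      (deviation (signedData x y) ubar (iterate x y α η u₀ (t + 1))) := by
  classical
  have hβ := iterate_snd_nonneg (x := x) (y := y) hη hα u₀ t
  rw [Step, deviation_succ_sub hη]
  set p := iterate x y α η u₀ t with hp
  set z := signedData x y with hz
  set e := deviation z ubar p with he
  have hinner : ∀ i, inner ℝ e (z i) =
      inner ℝ p.1 (z i) - p.2 / maxMargin z * inner ℝ ubar (z i) := fun i => by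
    rw [he, deviation, inner_sub_left, real_inner_smul_left]
  constructor
  · rw [increments, Finset.mem_image]
    exact ⟨(Finset.univ.filter fun i => inner ℝ p.1 (z i) ≤ p.2,
      decide (∀ i, p.2 ≤ inner ℝ p.1 (z i))), Finset.mem_univ _, by simp⟩
  · have h1 : ∑ i with inner ℝ p.1 (z i) ≤ p.2, inner ℝ e (z i) ≤ 0 := by
      refine Finset.sum_nonpos fun i hi => ?_
      have h2 : maxMargin z ≤ inner ℝ ubar (z i) := h.margin_eq ▸ margin_le z ubar i
      have h3 := mul_le_mul_of_nonneg_left h2 (div_nonneg hβ hγ.le)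
      rw [div_mul_cancel₀ _ hγ.ne'] at h3
      rw [hinner]
      linarith [(Finset.mem_filter.1 hi).2]
    rw [inner_sub_right, real_inner_smul_right, inner_sum, real_inner_smul_right]
    have h4 := mul_nonpos_of_nonneg_of_nonpos hη.le h1
    split_ifs with hall
    · have h5 : 0 ≤ inner ℝ e ubar := by
        refine h.inner_nonneg hγ ?_
        rintro _ ⟨⟨i, rfl⟩, hi⟩
        rw [hinner, hi, div_mul_cancel₀ _ hγ.ne']
        linarith [hall i]
      have h6 := mul_nonneg (div_nonneg hα.le hγ.le) h5
      linarith
    · linarith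

theorem exists_norm_deviation_le [Nonempty (Fin n)]
    (h : IsMaxMarginSeparator (signedData x y) ubar)
    (hγ : 0 < maxMargin (signedData x y))
    (hspan : Submodule.span ℝ (supportVectors (signedData x y) ubar) = ⊤)
    (hη : 0 < η) (hα : 0 < α) (u₀ : E d) :
    ∃ M : ℝ, ∀ t, ‖deviation (signedData x y) ubar (iterate x y α η u₀ t)‖ ≤ M := by
  obtain ⟨M, hM⟩ := boundedGain (increments (signedData x y) ubar α η)
  have htop : Submodule.span ℝ (increments (signedData x y) ubar α η : Set (E d)) = ⊤ := by
    refine top_unique (hspan ▸ Submodule.span_le.2 ?_)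
    rintro _ ⟨⟨i, rfl⟩, -⟩
    have hmem : η • signedData x y i ∈ increments (signedData x y) ubar α η := by
      classical
      rw [increments, Finset.mem_image]
      exact ⟨({i}, false), Finset.mem_univ _, by simp⟩
    have := Submodule.smul_mem _ η⁻¹ (Submodule.subset_span (R := ℝ) (Finset.mem_coe.2 hmem))
    rwa [inv_smul_smul₀ hη.ne'] at this
  refine ⟨_, fun t => hM (deviation (signedData x y) ubar (iterate x y α η u₀ 0))
    (htop ▸ Submodule.mem_top) _ ?_⟩
  induction t with
  | zero => exact .refl
  | succ t ih => exact ih.tail (step_deviation h hγ hη hα u₀ t)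

/-- Every iteration moves `⟪deviation, ubar⟫` up by at least `η γ`, or raises the level. As the
deviation is bounded, the level grows linearly. -/
theorem exists_le_level (h : IsMaxMarginSeparator (signedData x y) ubar)
    (hγ : 0 < maxMargin (signedData x y)) (hη : 0 < η) (hα : 0 < α) (u₀ : E d)
    {M : ℝ} (hM : ∀ t, ‖deviation (signedData x y) ubar (iterate x y α η u₀ t)‖ ≤ M) :
    ∃ c > 0, ∃ C : ℝ, ∀ t : ℕ, c * t - C ≤ (iterate x y α η u₀ t).2 := by
  classical
  set z := signedData x y with hz
  set γ := maxMargin z with hγdef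
  set k : ℝ := 1 / γ + η * γ / α with hk
  have hk0 : 0 < k := by positivity
  have hinc : ∀ t : ℕ, inner ℝ (deviation z ubar (iterate x y α η u₀ 0)) ubar + η * γ * t ≤
      inner ℝ (deviation z ubar (iterate x y α η u₀ t)) ubar + k * (iterate x y α η u₀ t).2 := by
    intro t
    induction t with
    | zero => simp [iterate]
    | succ t ih =>
      have h1 := congrArg (fun v => inner ℝ v ubar)
        (deviation_succ_sub (x := x) (y := y) (ubar := ubar) (α := α) hη u₀ t)
      rw [← hz] at h1
      simp only [inner_sub_left, real_inner_smul_left, sum_inner] at h1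
      rw [real_inner_self_eq_norm_sq, h.norm_eq_one] at h1
      rw [iterate_succ_snd hη, ← hz]
      have hγi : ∀ i, γ ≤ inner ℝ (z i) ubar := fun i => by
        rw [real_inner_comm, hγdef, ← h.margin_eq]; exact margin_le z ubar i
      set p := iterate x y α η u₀ t with hp
      push_cast
      split_ifs at h1 ⊢ with hall
      · have h2 : 0 ≤ ∑ i with inner ℝ p.1 (z i) ≤ p.2, inner ℝ (z i) ubar :=
          Finset.sum_nonneg fun i _ => hγ.le.trans (hγi i)
        have h3 := mul_nonneg hη.le h2
        have h4 : k * α = α / γ + η * γ := by rw [hk]; field_simp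
        linarith
      · push Not at hall
        obtain ⟨i, hi⟩ := hall
        have h2 : γ ≤ ∑ i with inner ℝ p.1 (z i) ≤ p.2, inner ℝ (z i) ubar :=
          (hγi i).trans (Finset.single_le_sum (f := fun i => (inner ℝ (z i) ubar : ℝ))
            (fun j _ => hγ.le.trans (hγi j)) (by simpa using hi.le))
        have h3 := mul_le_mul_of_nonneg_left h2 hη.le
        linarith
  have hbound : ∀ t, |inner ℝ (deviation z ubar (iterate x y α η u₀ t)) ubar| ≤ M := fun t => by
    refine (abs_real_inner_le_norm _ _).trans ?_
    rw [h.norm_eq_one, mul_one]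
    exact hM t
  refine ⟨η * γ / k, by positivity, 2 * M / k, fun t => ?_⟩
  have h1 := hinc t
  have h2 := (abs_le.1 (hbound 0)).1
  have h3 := (abs_le.1 (hbound t)).2
  have h4 : η * γ / k * t - 2 * M / k = (η * γ * t - 2 * M) / k := by ring
  rw [h4, div_le_iff₀ hk0]
  linarith

end Iterates

/-! ### Convergence of the direction -/

/-- If `u` is within `M` of `s • v`, then its direction is within `2 M / ‖u‖` of `v`. -/
theorem norm_inv_smul_sub_le {V : Type*} [NormedAddCommGroup V] [NormedSpace ℝ V]
    {u v : V} {s M : ℝ} (hv : ‖v‖ = 1) (hs : 0 ≤ s) (hu : u ≠ 0) (h : ‖u - s • v‖ ≤ M) :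
    ‖‖u‖⁻¹ • u - v‖ ≤ 2 * M / ‖u‖ := by
  have hu' : 0 < ‖u‖ := norm_pos_iff.2 hu
  have h1 : ‖u‖⁻¹ • u - v = ‖u‖⁻¹ • (u - ‖u‖ • v) := by
    rw [smul_sub, inv_smul_smul₀ hu'.ne']
  have h2 : ‖s • v‖ = s := by rw [norm_smul, hv, Real.norm_of_nonneg hs, mul_one]
  have h3 : |s - ‖u‖| ≤ M := by
    have := abs_norm_sub_norm_le (s • v) u
    rw [h2, norm_sub_rev] at this
    exact this.trans h
  have h4 : ‖u - ‖u‖ • v‖ ≤ 2 * M := by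
    have e : u - ‖u‖ • v = (u - s • v) + (s - ‖u‖) • v := by rw [sub_smul]; abel
    rw [e]
    refine (norm_add_le _ _).trans ?_
    rw [norm_smul, hv, Real.norm_eq_abs, mul_one]
    linarith
  rw [h1, norm_smul, norm_inv, norm_norm, inv_mul_eq_div]
  exact div_le_div_of_nonneg_right h4 hu'.le

end CompleteHinge

theorem theorem1 {d n : ℕ} (x : Fin n → EuclideanSpace ℝ (Fin d)) (y : Fin n → ℝ)
    (hx : Function.Injective x) (hy : ∀ i, y i = 1 ∨ y i = -1)
    (hsep : CompleteHinge.LinearlySeparable (CompleteHinge.signedData x y))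
    (ubar : EuclideanSpace ℝ (Fin d))
    (hubar : CompleteHinge.IsMaxMarginSeparator (CompleteHinge.signedData x y) ubar)
    (hspan : Submodule.span ℝ
      (CompleteHinge.supportVectors (CompleteHinge.signedData x y) ubar) = ⊤)
    (α η : ℝ) (hη : 0 < η)
    (hα : CompleteHinge.maxMargin (CompleteHinge.signedData x y) * η < α)
    (u₀ : EuclideanSpace ℝ (Fin d))
    (u : ℕ → EuclideanSpace ℝ (Fin d))
    (hu : ∀ t, u t = (CompleteHinge.iterate x y α η u₀ t).1) :
    (∀ᶠ t in atTop, u t ≠ 0) ∧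
    Asymptotics.IsBigO atTop
      (fun t : ℕ => CompleteHinge.maxMargin (CompleteHinge.signedData x y)
        - CompleteHinge.margin (CompleteHinge.signedData x y) (‖u t‖⁻¹ • u t))
      (fun t : ℕ => (n : ℝ) / (t : ℝ)) ∧
    Asymptotics.IsBigO atTop
      (fun t : ℕ => 1 - inner ℝ (‖u t‖⁻¹ • u t) ubar)
      (fun t : ℕ => (n : ℝ) / (t : ℝ)) ∧
    Asymptotics.IsBigO atTop
      (fun t : ℕ => ‖‖u t‖⁻¹ • u t - ubar‖)
      (fun t : ℕ => Real.sqrt ((n : ℝ) / (t : ℝ))) := by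
  open CompleteHinge in
  -- Without data the support vectors would span only the zero space, which has no unit vector.
  have hne : Nonempty (Fin n) := by
    by_contra hempty
    rw [not_nonempty_iff] at hempty
    have h0 : supportVectors (signedData x y) ubar = ∅ := by
      ext s
      simp [supportVectors, Set.range_eq_empty]
    rw [h0, Submodule.span_empty] at hspan
    have h1 : ubar ∈ (⊥ : Submodule ℝ (E d)) := hspan ▸ Submodule.mem_top
    rw [Submodule.mem_bot] at h1
    simpa [h1] using hubar.norm_eq_one
  have hn : (1 : ℝ) ≤ n := by
    have := Fin.pos_iff_nonempty.2 hne
    exact_mod_cast this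
  have hγ := maxMargin_pos hubar hsep
  have hα0 : 0 < α := (mul_pos hγ hη).trans hα
  obtain ⟨M, hM⟩ := exists_norm_deviation_le hubar hγ hspan hη hα0 u₀
  obtain ⟨c, hc, C, hC⟩ := exists_le_level hubar hγ hη hα0 u₀ hM
  set z := signedData x y with hz
  set γ := maxMargin z with hγdef
  have hM0 : 0 ≤ M := (norm_nonneg _).trans (hM 0)
  have hβ := iterate_snd_nonneg (x := x) (y := y) hη hα0 u₀
  have hdev : ∀ t, ‖u t - ((iterate x y α η u₀ t).2 / γ) • ubar‖ ≤ M := fun t => by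
    rw [hu]; exact hM t
  have hgrow : ∀ᶠ t : ℕ in atTop, 0 < (t : ℝ) ∧ c / (2 * γ) * t ≤ ‖u t‖ := by
    have h1 : Tendsto (fun t : ℕ => c / (2 * γ) * (t : ℝ)) atTop atTop :=
      tendsto_natCast_atTop_atTop.const_mul_atTop (by positivity)
    filter_upwards [h1.eventually_ge_atTop (C / γ + M), eventually_gt_atTop 0] with t ht ht0
    refine ⟨by exact_mod_cast ht0, ?_⟩
    have h2 : (c * t - C) / γ ≤ (iterate x y α η u₀ t).2 / γ :=
      div_le_div_of_nonneg_right (hC t) hγ.le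
    have h3 : ‖((iterate x y α η u₀ t).2 / γ) • ubar‖ = (iterate x y α η u₀ t).2 / γ := by
      rw [norm_smul, hubar.norm_eq_one, mul_one,
        Real.norm_of_nonneg (div_nonneg (hβ t) hγ.le)]
    have h4 := norm_sub_norm_le (((iterate x y α η u₀ t).2 / γ) • ubar) (u t)
    rw [norm_sub_rev, h3] at h4
    have h5 : (c * t - C) / γ = c / (2 * γ) * t + c / (2 * γ) * t - C / γ := by
      field_simp; ring
    linarith [hdev t]
  have hu0 : ∀ᶠ t in atTop, u t ≠ 0 := by
    filter_upwards [hgrow] with t ht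
    rw [← norm_pos_iff]
    exact (mul_pos (by positivity) ht.1).trans_le ht.2
  -- The direction converges at rate `1 / t`, from which all the claims follow.
  set D : ℝ := 2 * M / (c / (2 * γ)) with hD
  have hD0 : 0 ≤ D := by positivity
  have hdir : ∀ᶠ t : ℕ in atTop, ‖‖u t‖⁻¹ • u t - ubar‖ ≤ D * (n / t) ∧
      ‖‖u t‖⁻¹ • u t‖ = 1 ∧ 1 ≤ (t : ℝ) := by
    filter_upwards [hgrow, hu0, eventually_ge_atTop 1] with t ht ht0 ht1
    refine ⟨?_, by rw [norm_smul, norm_inv, norm_norm, inv_mul_cancel₀ (norm_ne_zero_iff.2 ht0)],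
      by exact_mod_cast ht1⟩
    refine (norm_inv_smul_sub_le hubar.norm_eq_one (div_nonneg (hβ t) hγ.le) ht0 (hdev t)).trans ?_
    have ht' : 0 < c / (2 * γ) * t := mul_pos (by positivity) ht.1
    calc 2 * M / ‖u t‖ ≤ 2 * M / (c / (2 * γ) * t) :=
          div_le_div_of_nonneg_left (by positivity) ht' ht.2
      _ = D * (1 / t) := by rw [hD]; field_simp
      _ ≤ D * (n / t) := by gcongr
  refine ⟨hu0, ?_, ?_, ?_⟩
  · refine Asymptotics.IsBigO.of_bound ((∑ i, ‖z i‖) * D) ?_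
    filter_upwards [hdir] with t ht
    rw [hγdef, ← hubar.margin_eq, Real.norm_eq_abs, abs_sub_comm,
      Real.norm_of_nonneg (by positivity), mul_assoc]
    exact (abs_margin_sub_le _ _).trans (mul_le_mul_of_nonneg_left ht.1 (by positivity))
  · refine Asymptotics.IsBigO.of_bound D ?_
    filter_upwards [hdir] with t ht
    have h1 : ‖‖u t‖⁻¹ • u t - ubar‖ ^ 2 = 2 * (1 - inner ℝ (‖u t‖⁻¹ • u t) ubar) := by
      rw [norm_sub_sq_real, ht.2.1, hubar.norm_eq_one]; ring
    have h2 : ‖‖u t‖⁻¹ • u t - ubar‖ ≤ 2 := by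
      refine (norm_sub_le _ _).trans ?_
      rw [ht.2.1, hubar.norm_eq_one]; norm_num
    have h3 : ‖‖u t‖⁻¹ • u t - ubar‖ ^ 2 ≤ 2 * ‖‖u t‖⁻¹ • u t - ubar‖ := by
      rw [sq]; exact mul_le_mul_of_nonneg_right h2 (norm_nonneg _)
    have h4 := sq_nonneg ‖‖u t‖⁻¹ • u t - ubar‖
    rw [Real.norm_of_nonneg (by linarith), Real.norm_of_nonneg (by positivity)]
    linarith [ht.1]
  · -- If `n / t ≤ 1` then `n / t ≤ √(n / t)`; otherwise the trivial bound `2` suffices.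
    refine Asymptotics.IsBigO.of_bound (2 + D) ?_
    filter_upwards [hdir] with t ht
    have h2 : ‖‖u t‖⁻¹ • u t - ubar‖ ≤ 2 := by
      refine (norm_sub_le _ _).trans ?_
      rw [ht.2.1, hubar.norm_eq_one]; norm_num
    rw [norm_norm, Real.norm_of_nonneg (Real.sqrt_nonneg _)]
    have hr : (0 : ℝ) ≤ n / t := by positivity
    rcases le_total ((n : ℝ) / t) 1 with hle | hge
    · have h3 : (n : ℝ) / t ≤ Real.sqrt (n / t) := Real.le_sqrt_of_sq_le (by nlinarith)
      have h4 := mul_le_mul_of_nonneg_left h3 hD0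
      linarith [ht.1, Real.sqrt_nonneg ((n : ℝ) / t)]
    · have h3 : 1 ≤ Real.sqrt (n / t) := Real.one_le_sqrt.2 hge
      nlinarith [mul_nonneg hD0 (Real.sqrt_nonneg ((n : ℝ) / t))]
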